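/- Let $P_{\mathrm{x},\mathrm{y}}$ be a probability measure on $\mathcal X\times\mathcal Y$ with input marginal $P$ and conditional distribution (Markov kernel) $P_{\mathrm{y}|\mathrm{x}}$, let $h:\mathcal X\to\mathcal Y'$ be a model and $\ell:\mathcal Y\times\mathcal Y'\to\mathbb R$ a loss with $\mathbb E_{P_{\mathrm{x},\mathrm{y}}}|\ell(Y,h(X))|<\infty$. Put $L'(x)=\mathbb E_{P_{\mathrm{y}|\mathrm{x}=x}}[\ell(Y,h(x))]$ and $L(Q)=\mathbb E_Q[L'(X)]\in[-\infty,\infty]$ for probability measures $Q$ on $\mathcal X$ (with the value $-\infty$ if the expectation is undefined; expectations of $\ell$ below are read in the same way). Let $\varphi:\mathbb R\to(-\infty,\infty]$ be convex and lower semicontinuous with $\varphi(1)=0$, finite and differentiable on $(0,\infty)$ with $\varphi'$ injective there, and let $D_\varphi(P\,\|\,Q)=\int\varphi\left(\frac{dQ}{dP}\right)dP$ if $Q\ll P$ and $+\infty$ otherwise. Let $\varepsilon>0$. Suppose that for every $\lambda>0$ the probability measure $Q_\lambda$ on $\mathcal X$ satisfies $\mathbb E_{Q_\lambda(dx)P_{\mathrm{y}|\mathrm{x}}(dy)}|\ell(Y,h(X))|<\infty$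 and minimizes $$-L(Q)+\lambda\,D_\varphi(P\,\|\,Q)$$ over all probability measures $Q$ on $\mathcal X$ (the objective being $+\infty$ where $D_\varphi(P\,\|\,Q)=+\infty$), and let $$\lambda^\star\in\operatorname*{arg\,sup}_{\lambda>0}\left\{-L(Q_\lambda)+\lambda\left(D_\varphi(P\,\|\,Q_\lambda)-\varepsilon\right)\right\}.$$ Then $Q_{\lambda^\star}$ is the optimal adversarial distribution of the inner DRO problem over input distributions: $$D_\varphi(P\,\|\,Q_{\lambda^\star})\le\varepsilon,\qquad L(Q_{\lambda^\star})=\max_{Q:\,D_\varphi(P\|Q)\le\varepsilon}L(Q)=\sup_{Q:\,D_\varphi(P\|Q)<\varepsilon}L(Q).$$ Equivalently, in terms of joint distributions, $\bar Q^\star(dx,dy)=Q_{\lambda^\star}(dx)P_{\mathrm{y}|\mathrm{x}}(dy)$ satisfies $D_\varphi(P_{\mathrm{x},\mathrm{y}}\,\|\,\bar Q^\star)\le\varepsilon$, it maximizes $\mathbb E_{\bar Q}[\ell(Y,h(X))]$ over all $\bar Q(dx,dy)=Q(dx)P_{\mathrm{y}|\mathrm{x}}(dy)$ with $Q$ a probability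 measure and $D_\varphi(P_{\mathrm{x},\mathrm{y}}\,\|\,\bar Q)\le\varepsilon$, and its value is the supremum over those with $D_\varphi(P_{\mathrm{x},\mathrm{y}}\,\|\,\bar Q)<\varepsilon$. -/

import Mathlib

open MeasureTheory ProbabilityTheory Set
open scoped ENNReal

noncomputable section

/-- Extended-real integral: integral of the positive part minus integral of the negative part.
(If both are infinite, the integral is undefined and takes the placeholder value `⊥`.) -/
def extIntegral {α : Type*} [MeasurableSpace α] (μ : Measure α) (f : α → EReal) : EReal :=
  ((∫⁻ x, (f x).toENNReal ∂μ : ℝ≥0∞) : EReal) - ((∫⁻ x, (-f x).toENNReal ∂μ : ℝ≥0∞) : EReal)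

/-- Generators of divergences: convex lower semicontinuous `φ : ℝ → (-∞, ∞]` with `φ 1 = 0`. -/
structure IsDivGenerator (φ : ℝ → EReal) : Prop where
  ne_bot : ∀ z, φ z ≠ ⊥
  convex : ∀ x y a b : ℝ, 0 ≤ a → 0 ≤ b → a + b = 1 →
    φ (a * x + b * y) ≤ (a : EReal) * φ x + (b : EReal) * φ y
  lsc : LowerSemicontinuous φ
  one : φ 1 = 0

open Classical in
/-- The `φ`-divergence `D_φ(P ‖ Q) = ∫ φ(dQ/dP) dP` if `Q ≪ P`, and `+∞` otherwise. -/
def phiDiv {α : Type*} [MeasurableSpace α] (φ : ℝ → EReal) (P Q : Measure α) : EReal :=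
  if Q ≪ P then extIntegral P (fun x => φ (Q.rnDeriv P x).toReal) else ⊤

/-- The open ball `{Q : D_φ(P ‖ Q) < ε}` of probability measures. -/
def phiBall {α : Type*} [MeasurableSpace α] (φ : ℝ → EReal) (P : Measure α) (ε : ℝ) :
    Set (Measure α) :=
  {Q | IsProbabilityMeasure Q ∧ phiDiv φ P Q < (ε : EReal)}

/-- The closed ball `{Q : D_φ(P ‖ Q) ≤ ε}` of probability measures. -/
def phiClosedBall {α : Type*} [MeasurableSpace α] (φ : ℝ → EReal) (P : Measure α) (ε : ℝ) :
    Set (Measure α) :=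
  {Q | IsProbabilityMeasure Q ∧ phiDiv φ P Q ≤ (ε : EReal)}

/-- The pointwise conditional risk `L'(x) = E_{Y ∼ κ(x)} [ℓ(Y, h(x))]`. -/
def condRisk {X Y Y' : Type*} [MeasurableSpace X] [MeasurableSpace Y]
    (κ : Kernel X Y) (ℓ : Y → Y' → ℝ) (h : X → Y') (x : X) : ℝ :=
  ∫ y, ℓ y (h x) ∂(κ x)

/-- The risk `L(Q) = E_Q[L'(X)]` of an input distribution `Q`. -/
def inputRisk {X Y Y' : Type*} [MeasurableSpace X] [MeasurableSpace Y]
    (κ : Kernel X Y) (ℓ : Y → Y' → ℝ) (h : X → Y') (Q : Measure X) : EReal :=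
  extIntegral Q (fun x => (condRisk κ ℓ h x : EReal))

/-- The risk `E_{(X,Y) ∼ R}[ℓ(Y, h(X))]` of a joint distribution `R`. -/
def jointRisk {X Y Y' : Type*} [MeasurableSpace X] [MeasurableSpace Y]
    (ℓ : Y → Y' → ℝ) (h : X → Y') (R : Measure (X × Y)) : EReal :=
  extIntegral R (fun p => (ℓ p.2 (h p.1) : EReal))

open Classical in
/-- The regularized objective `L(Q) + lam · D_φ(P ‖ Q)`, which is `+∞` where the divergence is. -/
def idealObjective {X : Type*} [MeasurableSpace X] (φ : ℝ → EReal) (P : Measure X)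
    (L : Measure X → EReal) (lam : ℝ) (Q : Measure X) : EReal :=
  if phiDiv φ P Q = ⊤ then ⊤ else L Q + (lam : EReal) * phiDiv φ P Q

/-- `Q` is an idealized distribution: it minimizes `L(Q) + lam · D_φ(P ‖ Q)` over all
probability measures on `X`. -/
def IsIdealized {X : Type*} [MeasurableSpace X] (φ : ℝ → EReal) (P : Measure X)
    (L : Measure X → EReal) (lam : ℝ) (Q : Measure X) : Prop :=
  IsProbabilityMeasure Q ∧ ∀ Q' : Measure X, IsProbabilityMeasure Q' →
    idealObjective φ P L lam Q ≤ idealObjective φ P L lam Q'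

/-- Joint distributions `Q(dx) κ(x, dy)` obtained by changing only the input marginal. -/
def inputShifts {X Y : Type*} [MeasurableSpace X] [MeasurableSpace Y] (κ : Kernel X Y) :
    Set (Measure (X × Y)) :=
  {R | ∃ Q : Measure X, IsProbabilityMeasure Q ∧ R = Q ⊗ₘ κ}

end

/-!
Write `P` for the input marginal, `r = condRisk κ ℓ h`, `q = dQ/dP` and `f` for the real-valued
part of `φ`. The hypothesis says that `q_λ` minimizes `λ ∫ f(q) dP - ∫ r q dP` over probability
densities, and that the dual value `g(λ) = λ (D(q_λ) - ε) - ∫ r q_λ dP` is largest at `λ⋆`, where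
`D(q) = ∫ f(q) dP`. If `D(q_λ⋆) = ε`, then `Q_λ⋆` is optimal by weak duality (`IsIdealized.risk_le`)
and the mixtures `(1 - t) Q_λ⋆ + t P` approach its risk from inside the open ball, because `ε > 0`.

The heart of the matter is therefore `D(q_λ⋆) = ε` (`IsPenalizedMin.cost_eq_of_dual_max`), that is,
differentiability of the concave function `g` at `λ⋆`. Maximality gives `D(q_μ) ≤ ε` for `μ > λ⋆` and
`D(q_μ) ≥ ε` for `μ < λ⋆`, and these inequalities have to pass to the limit `μ → λ⋆`:

* The `q_μ` form a minimizing sequence for the problem at `λ⋆`. Since `φ'` is injective, `φ` is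
  strictly convex, so comparing with the midpoints of `q_μ` and `q_λ⋆` gives `q_μ → q_λ⋆` almost
  everywhere along a subsequence (`IsPenalizedMin.exists_subseq_tendsto_ae`).
* For the limit of the integrals, fix `λ' ≠ λ⋆` on the side of the `μ`. A Lagrange multiplier `c` for
  the mass constraint makes `λ' f(q) - r q - c q` at least its value at `q_λ'`, almost everywhere and
  for every `q` (`IsPenalizedMin.exists_pointwise_multiplier`). This is an integrable minorant, and
  Fatou's lemma gives `(λ' - λ⋆) (D(q_λ⋆) - ε) ≤ 0` (`IsPenalizedMin.mul_cost_sub_nonpos`). The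
  choices `λ' = λ⋆ / 2` and `λ' = 2 λ⋆` yield both inequalities.

The joint statement reduces to the one for inputs: the divergence is unchanged by composition with
`κ` (`phiDiv_compProd`), and the joint risk is at most the input risk, with equality when the loss is
integrable (`extIntegral_compProd_le`, `extIntegral_compProd_eq`).
-/

open Filter Topology

/-! ### Strict convexity of the generator -/

/-- Real-valued strictly convex cost functions on an interval `S` of densities: the finite part of
a generator of a `φ`-divergence. -/
structure IsEntropy (S : Set ℝ) (f : ℝ → ℝ) : Prop where
  nonneg : S ⊆ Ici 0
  pos : Ioi 0 ⊆ S
  strictConvexOn : StrictConvexOn ℝ S f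
  continuousOn : ContinuousOn f S
  measurable : Measurable f
  one : f 1 = 0

/-- The midpoint gap `f s + f t - 2 f ((s + t) / 2)` of a convex function grows along rays
from `t`. -/
lemma ConvexOn.midpoint_gap_le {S : Set ℝ} {f : ℝ → ℝ} (hf : ConvexOn ℝ S f) {t d k : ℝ}
    (hk : 1 ≤ k) (ht : t ∈ S) (hs : t + k * d ∈ S) :
    t + d ∈ S ∧ f (t + d) + f t - 2 * f ((t + d + t) / 2) ≤
      f (t + k * d) + f t - 2 * f ((t + k * d + t) / 2) := by
  have hseg : ∀ c : ℝ, 0 ≤ c → c ≤ k → t + c * d ∈ S := by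
    intro c hc hck
    have h1 := hf.1 ht hs
      (show 0 ≤ 1 - c / k by rw [sub_nonneg, div_le_one (by linarith)]; exact hck)
      (show 0 ≤ c / k by positivity) (by ring)
    convert h1 using 1
    simp only [smul_eq_mul]
    field_simp
    ring
  have hhalf : t + 1 / 2 * d ∈ S := hseg _ (by norm_num) (by linarith)
  obtain ⟨i, hi0, hi⟩ : ∃ i : ℝ, 0 ≤ i ∧ (2 * k - 1) * i = 1 :=
    ⟨(2 * k - 1)⁻¹, inv_nonneg.2 (by linarith), mul_inv_cancel₀ (by linarith)⟩
  have hk' : 0 ≤ k - 1 := by linarith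
  -- both `t + d` and the midpoint `t + (k / 2) d` lie between `t + d / 2` and `t + k d`
  have h1 := hf.2 hhalf hs (show 0 ≤ 2 * (k - 1) * i by positivity) hi0
    (by linear_combination hi)
  have h2 := hf.2 hhalf hs (show 0 ≤ k * i by positivity) (show 0 ≤ (k - 1) * i by positivity)
    (by linear_combination hi)
  have e1 : (2 * (k - 1) * i) • (t + 1 / 2 * d) + i • (t + k * d) = t + d := by
    simp only [smul_eq_mul]; linear_combination (t + d) * hi
  have e2 : (k * i) • (t + 1 / 2 * d) + ((k - 1) * i) • (t + k * d) = (t + k * d + t) / 2 := by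
    simp only [smul_eq_mul]; linear_combination (t + k * d / 2) * hi
  rw [e1] at h1
  rw [e2] at h2
  have e3 : (t + d + t) / 2 = t + 1 / 2 * d := by ring
  refine ⟨by simpa using hseg 1 zero_le_one hk, ?_⟩
  rw [e3]
  simp only [smul_eq_mul] at h1 h2
  linear_combination h1 + 2 * h2 + (2 * f (t + 1 / 2 * d) + f (t + k * d)) * hi

/-- For a strictly convex function, a vanishing midpoint gap forces convergence. -/
lemma StrictConvexOn.tendsto_of_midpoint_gap {S : Set ℝ} {f : ℝ → ℝ} (hf : StrictConvexOn ℝ S f)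
    {t : ℝ} (ht : t ∈ S) {s : ℕ → ℝ} (hs : ∀ n, s n ∈ S)
    (h : Tendsto (fun n => f (s n) + f t - 2 * f ((s n + t) / 2)) atTop (𝓝 0)) :
    Tendsto s atTop (𝓝 t) := by
  -- along a ray `t + k d` with `k ≥ 1` the gap stays above its positive value at `k = 1`
  have key : ∀ d : ℝ, d ≠ 0 → ∀ᶠ n in atTop, ¬ ∃ k : ℝ, 1 ≤ k ∧ s n = t + k * d := by
    intro d hd
    by_cases htd : t + d ∈ S
    · have hgap : 0 < f (t + d) + f t - 2 * f ((t + d + t) / 2) := by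
        have := hf.2 htd ht (by simpa using hd) (show (0 : ℝ) < 1 / 2 by norm_num)
          (show (0 : ℝ) < 1 / 2 by norm_num) (by norm_num)
        simp only [smul_eq_mul] at this
        rw [show 1 / 2 * (t + d) + 1 / 2 * t = (t + d + t) / 2 by ring] at this
        linarith
      filter_upwards [h.eventually_lt_const hgap] with n hn
      rintro ⟨k, hk, hsn⟩
      have := (hf.convexOn.midpoint_gap_le hk ht (hsn ▸ hs n)).2
      rw [hsn] at hn
      linarith
    · refine Eventually.of_forall fun n => ?_
      rintro ⟨k, hk, hsn⟩
      exact htd (hf.convexOn.midpoint_gap_le hk ht (hsn ▸ hs n)).1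
  rw [Metric.tendsto_atTop']
  intro η hη
  obtain ⟨N, hN⟩ := eventually_atTop.1 ((key η hη.ne').and (key (-η) (neg_ne_zero.2 hη.ne')))
  refine ⟨N, fun n hn => ?_⟩
  obtain ⟨h1, h2⟩ := hN n hn.le
  rw [Real.dist_eq, abs_lt]
  constructor
  · by_contra! hle
    exact h2 ⟨(t - s n) / η, by rw [le_div_iff₀ hη]; linarith, by field_simp; ring⟩
  · by_contra! hle
    exact h1 ⟨(s n - t) / η, by rw [le_div_iff₀ hη]; linarith, by field_simp; ring⟩

/-- Affine minorant through the point `(1, 0)`. -/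
lemma IsEntropy.exists_affine_le {S : Set ℝ} {f : ℝ → ℝ} (hf : IsEntropy S f) :
    ∃ a : ℝ, ∀ t ∈ S, a * (t - 1) ≤ f t := by
  have h1 : (1 : ℝ) ∈ interior S :=
    interior_mono hf.pos (by rw [interior_Ioi]; exact mem_Ioi.2 one_pos)
  have hc := hf.strictConvexOn.convexOn
  refine ⟨derivWithin f (Ioi 1) 1, fun t ht => ?_⟩
  rcases lt_trichotomy t 1 with h | h | h
  · have h2 := hc.slope_le_leftDeriv_of_mem_interior ht h1 h
    have h3 := hc.leftDeriv_le_rightDeriv_of_mem_interior h1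
    have h4 := h2.trans h3
    rw [slope_def_field, hf.one, div_le_iff₀ (by linarith)] at h4
    linarith
  · simp [h, hf.one]
  · have h2 := hc.rightDeriv_le_slope_of_mem_interior h1 ht h
    rw [slope_def_field, hf.one, le_div_iff₀ (by linarith)] at h2
    linarith

/-- The densities at which a generator is finite. -/
def genDomain (φ : ℝ → EReal) : Set ℝ := {t | 0 ≤ t ∧ φ t ≠ ⊤}

namespace IsDivGenerator

variable {φ : ℝ → EReal}

lemma coe_toReal (hφ : IsDivGenerator φ) {t : ℝ} (ht : φ t ≠ ⊤) :
    ((φ t).toReal : EReal) = φ t :=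
  EReal.coe_toReal ht (hφ.ne_bot t)

lemma le_combo (hφ : IsDivGenerator φ) {x y a b : ℝ} (hx : φ x ≠ ⊤) (hy : φ y ≠ ⊤) (ha : 0 ≤ a)
    (hb : 0 ≤ b) (hab : a + b = 1) :
    φ (a * x + b * y) ≤ ((a * (φ x).toReal + b * (φ y).toReal : ℝ) : EReal) := by
  have h := hφ.convex x y a b ha hb hab
  rw [← hφ.coe_toReal hx, ← hφ.coe_toReal hy] at h
  exact_mod_cast h

lemma convexOn (hφ : IsDivGenerator φ) :
    ConvexOn ℝ (genDomain φ) (fun t => (φ t).toReal) := by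
  have key : ∀ ⦃x⦄, x ∈ genDomain φ → ∀ ⦃y⦄, y ∈ genDomain φ → ∀ ⦃a b : ℝ⦄, 0 ≤ a → 0 ≤ b →
      a + b = 1 → φ (a * x + b * y) ≠ ⊤ := fun x hx y hy a b ha hb hab =>
    ((hφ.le_combo hx.2 hy.2 ha hb hab).trans_lt (EReal.coe_lt_top _)).ne
  refine ⟨fun x hx y hy a b ha hb hab => ⟨?_, key hx hy ha hb hab⟩,
    fun x hx y hy a b ha hb hab => ?_⟩
  · exact add_nonneg (mul_nonneg ha hx.1) (mul_nonneg hb hy.1)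
  · have h := hφ.le_combo hx.2 hy.2 ha hb hab
    rw [← hφ.coe_toReal (key hx hy ha hb hab)] at h
    exact_mod_cast h

lemma Ioi_subset (hfin : ∀ z : ℝ, 0 < z → φ z ≠ ⊤) : Ioi 0 ⊆ genDomain φ :=
  fun z hz => ⟨le_of_lt hz, hfin z hz⟩

/-- Convexity gives continuity inside the domain; at the boundary point `0`, lower semicontinuity
is matched by the upper bound `φ t ≤ (1 - t) φ 0 + t φ 1`. -/
lemma continuousOn (hφ : IsDivGenerator φ) (hfin : ∀ z : ℝ, 0 < z → φ z ≠ ⊤) :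
    ContinuousOn (fun t => (φ t).toReal) (genDomain φ) := by
  intro t ht
  rcases ht.1.eq_or_lt with h0 | h0
  · subst h0
    refine tendsto_order.2 ⟨fun y hy => ?_, fun y hy => ?_⟩
    · have hy' : (y : EReal) < φ 0 := by rw [← hφ.coe_toReal ht.2]; exact_mod_cast hy
      filter_upwards [(hφ.lsc 0 y hy').filter_mono nhdsWithin_le_nhds, self_mem_nhdsWithin]
        with s hs hsS
      rw [← hφ.coe_toReal hsS.2] at hs
      exact_mod_cast hs
    · have hlim : Tendsto (fun s : ℝ => (1 - s) * (φ 0).toReal + s * (φ 1).toReal)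
          (𝓝[genDomain φ] 0) (𝓝 ((1 - 0) * (φ 0).toReal + 0 * (φ 1).toReal)) :=
        (Continuous.tendsto (by fun_prop) 0).mono_left nhdsWithin_le_nhds
      have h1 : ∀ᶠ s : ℝ in 𝓝[genDomain φ] 0, s < 1 :=
        (eventually_lt_nhds one_pos).filter_mono nhdsWithin_le_nhds
      filter_upwards [hlim.eventually_lt_const (by simpa using hy), h1, self_mem_nhdsWithin]
        with s hs hs1 hsS
      have h2 := hφ.convexOn.2 ht (Ioi_subset hfin (mem_Ioi.2 one_pos)) (sub_nonneg.2 hs1.le)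
        hsS.1 (by ring)
      simp only [smul_eq_mul, mul_zero, mul_one, zero_add] at h2
      exact h2.trans_lt hs
  · have h1 : ContinuousOn (fun t => (φ t).toReal) (Ioi 0) :=
      (hφ.convexOn.subset (Ioi_subset hfin) (convex_Ioi 0)).continuousOn isOpen_Ioi
    exact (h1.continuousAt (Ioi_mem_nhds h0)).continuousWithinAt

lemma interior_genDomain (hfin : ∀ z : ℝ, 0 < z → φ z ≠ ⊤) :
    interior (genDomain φ) = Ioi 0 := by
  refine Subset.antisymm ?_ (interior_maximal (Ioi_subset hfin) isOpen_Ioi)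
  rw [← interior_Ici]
  exact interior_mono fun t ht => ht.1

/-- Injectivity makes the monotone derivative of a convex function strictly monotone. -/
lemma isEntropy (hφ : IsDivGenerator φ) (hfin : ∀ z : ℝ, 0 < z → φ z ≠ ⊤)
    (hdiff : DifferentiableOn ℝ (fun z => (φ z).toReal) (Ioi 0))
    (hinj : InjOn (deriv fun z => (φ z).toReal) (Ioi 0)) :
    IsEntropy (genDomain φ) (fun t => (φ t).toReal) where
  nonneg := fun t ht => ht.1
  pos := Ioi_subset hfin
  strictConvexOn := by
    refine StrictMonoOn.strictConvexOn_of_deriv hφ.convexOn.1 (hφ.continuousOn hfin) ?_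
    rw [interior_genDomain hfin]
    have hmono := (hφ.convexOn.subset (Ioi_subset hfin) (convex_Ioi 0)).monotoneOn_deriv
      fun x hx => (hdiff x hx).differentiableAt (Ioi_mem_nhds hx)
    exact fun x hx y hy hxy => lt_of_le_of_ne (hmono hx hy hxy.le)
      fun h => hxy.ne (hinj hx hy h)
  continuousOn := hφ.continuousOn hfin
  measurable := hφ.lsc.measurable.ereal_toReal
  one := by simp [hφ.one]

end IsDivGenerator

/-! ### The penalized problem for densities and its Lagrange multiplier -/

/-- Fatou's lemma for real functions with a common integrable minorant. -/
lemma integral_le_of_tendsto_ae {X : Type*} [MeasurableSpace X] {P : Measure X}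
    {u : ℕ → X → ℝ} {v m : X → ℝ} {C : ℕ → ℝ} {C' : ℝ}
    (hu : ∀ n, Integrable (u n) P) (hv : Integrable v P) (hm : Integrable m P)
    (hmu : ∀ n, ∀ᵐ x ∂P, m x ≤ u n x) (hlim : ∀ᵐ x ∂P, Tendsto (fun n => u n x) atTop (𝓝 (v x)))
    (huC : ∀ n, ∫ x, u n x ∂P ≤ C n) (hC : Tendsto C atTop (𝓝 C')) : ∫ x, v x ∂P ≤ C' := by
  have hmu' := ae_all_iff.2 hmu
  have hmv : ∀ᵐ x ∂P, m x ≤ v x := by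
    filter_upwards [hmu', hlim] with x h1 h2
    exact ge_of_tendsto' h2 h1
  have hmC : ∫ x, m x ∂P ≤ C' :=
    ge_of_tendsto' hC fun n => (integral_mono_ae hm (hu n) (hmu n)).trans (huC n)
  have h1 : ENNReal.ofReal (∫ x, v x - m x ∂P) ≤ ENNReal.ofReal (C' - ∫ x, m x ∂P) := by
    rw [ofReal_integral_eq_lintegral_ofReal (f := fun x => v x - m x) (hv.sub hm)
      (by filter_upwards [hmv] with x hx using sub_nonneg.2 hx)]
    calc ∫⁻ x, ENNReal.ofReal (v x - m x) ∂P
        = ∫⁻ x, liminf (fun n => ENNReal.ofReal (u n x - m x)) atTop ∂P := by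
          refine lintegral_congr_ae ?_
          filter_upwards [hlim] with x hx
          exact (((ENNReal.continuous_ofReal.tendsto _).comp
            (hx.sub_const (m x))).liminf_eq).symm
      _ ≤ liminf (fun n => ∫⁻ x, ENNReal.ofReal (u n x - m x) ∂P) atTop :=
          lintegral_liminf_le' fun n => ((hu n).sub hm).aemeasurable.ennreal_ofReal
      _ ≤ liminf (fun n => ENNReal.ofReal (C n - ∫ x, m x ∂P)) atTop := by
          refine liminf_le_liminf (Eventually.of_forall fun n => ?_)
          rw [← ofReal_integral_eq_lintegral_ofReal (f := fun x => u n x - m x)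
            ((hu n).sub hm)
            (by filter_upwards [hmu n] with x hx using sub_nonneg.2 hx)]
          refine ENNReal.ofReal_le_ofReal ?_
          rw [integral_sub (hu n) hm]
          exact sub_le_sub_right (huC n) _
      _ = ENNReal.ofReal (C' - ∫ x, m x ∂P) :=
          ((ENNReal.continuous_ofReal.tendsto _).comp (hC.sub_const _)).liminf_eq
  rw [ENNReal.ofReal_le_ofReal_iff (sub_nonneg.2 hmC), integral_sub hv hm] at h1
  linarith

section Lagrangian

variable {X : Type*} [MeasurableSpace X] {P : Measure X} {S : Set ℝ} {f : ℝ → ℝ} {r : X → ℝ}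

/-- Densities, not necessarily of total mass one, with values in `S`, finite cost `∫ f(q) dP` and
finite gain `∫ r q dP`. -/
structure FiniteCost (P : Measure X) (S : Set ℝ) (f : ℝ → ℝ) (r q : X → ℝ) : Prop where
  mem : ∀ᵐ x ∂P, q x ∈ S
  integrable : Integrable q P
  integrable_cost : Integrable (fun x => f (q x)) P
  integrable_gain : Integrable (fun x => r x * q x) P

/-- The penalized objective `lam ∫ f(q) dP - ∫ r q dP` in terms of densities. -/
noncomputable def penalized (P : Measure X) (f : ℝ → ℝ) (r : X → ℝ) (lam : ℝ) (q : X → ℝ) : ℝ :=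
  ∫ x, (lam * f (q x) - r x * q x) ∂P

/-- `p` is a probability density minimizing the penalized objective. -/
structure IsPenalizedMin (P : Measure X) (S : Set ℝ) (f : ℝ → ℝ) (r : X → ℝ) (lam : ℝ)
    (p : X → ℝ) : Prop where
  finiteCost : FiniteCost P S f r p
  mass : ∫ x, p x ∂P = 1
  le : ∀ q, FiniteCost P S f r q → ∫ x, q x ∂P = 1 → penalized P f r lam p ≤ penalized P f r lam q

namespace FiniteCost

variable {p q : X → ℝ}

lemma integrable_penalized (hq : FiniteCost P S f r q) (lam : ℝ) :
    Integrable (fun x => lam * f (q x) - r x * q x) P :=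
  (hq.integrable_cost.const_mul lam).sub hq.integrable_gain

lemma penalized_eq (hq : FiniteCost P S f r q) (lam : ℝ) :
    penalized P f r lam q = lam * ∫ x, f (q x) ∂P - ∫ x, r x * q x ∂P := by
  rw [penalized, integral_sub (hq.integrable_cost.const_mul lam) hq.integrable_gain,
    integral_const_mul]

lemma penalized_sub (hq : FiniteCost P S f r q) (lam mu : ℝ) :
    penalized P f r lam q = penalized P f r mu q + (lam - mu) * ∫ x, f (q x) ∂P := by
  rw [hq.penalized_eq, hq.penalized_eq]; ring

lemma const [IsFiniteMeasure P] (hr : Integrable r P) {t : ℝ} (ht : t ∈ S) :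
    FiniteCost P S f r (fun _ => t) where
  mem := Eventually.of_forall fun _ => ht
  integrable := integrable_const _
  integrable_cost := integrable_const _
  integrable_gain := hr.mul_const _

lemma combo_cost_le (hf : IsEntropy S f) (hp : FiniteCost P S f r p) (hq : FiniteCost P S f r q)
    {a b : ℝ} (ha : 0 ≤ a) (hb : 0 ≤ b) (hab : a + b = 1) :
    ∀ᵐ x ∂P, f (a * p x + b * q x) ≤ a * f (p x) + b * f (q x) := by
  filter_upwards [hp.mem, hq.mem] with x h1 h2
  exact hf.strictConvexOn.convexOn.2 h1 h2 ha hb hab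

/-- The cost of a mixture lies between an affine function and the mixture of the costs. -/
lemma combo [IsFiniteMeasure P] (hf : IsEntropy S f) (hp : FiniteCost P S f r p)
    (hq : FiniteCost P S f r q) {a b : ℝ} (ha : 0 ≤ a) (hb : 0 ≤ b) (hab : a + b = 1) :
    FiniteCost P S f r (fun x => a * p x + b * q x) := by
  have hmem : ∀ᵐ x ∂P, a * p x + b * q x ∈ S := by
    filter_upwards [hp.mem, hq.mem] with x h1 h2
    exact hf.strictConvexOn.1 h1 h2 ha hb hab
  have hint : Integrable (fun x => a * p x + b * q x) P :=
    (hp.integrable.const_mul a).add (hq.integrable.const_mul b)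
  refine ⟨hmem, hint, ?_, ?_⟩
  · obtain ⟨k, hk⟩ := hf.exists_affine_le
    refine integrable_of_le_of_le (hf.measurable.comp_aemeasurable
      hint.aemeasurable).aestronglyMeasurable (g₁ := fun x => k * ((a * p x + b * q x) - 1)) ?_
      (combo_cost_le hf hp hq ha hb hab) ((hint.sub (integrable_const 1)).const_mul k)
      ((hp.integrable_cost.const_mul a).add (hq.integrable_cost.const_mul b))
    filter_upwards [hmem] with x hx using hk _ hx
  · refine ((hp.integrable_gain.const_mul a).add (hq.integrable_gain.const_mul b)).congr ?_
    refine Eventually.of_forall fun x => ?_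
    simp only [Pi.add_apply]
    ring

lemma mass_combo (hp : FiniteCost P S f r p) (hq : FiniteCost P S f r q) (a b : ℝ) :
    ∫ x, (a * p x + b * q x) ∂P = a * ∫ x, p x ∂P + b * ∫ x, q x ∂P := by
  rw [integral_add (hp.integrable.const_mul a) (hq.integrable.const_mul b), integral_const_mul,
    integral_const_mul]

lemma gain_combo (hp : FiniteCost P S f r p) (hq : FiniteCost P S f r q) (a b : ℝ) :
    ∫ x, r x * (a * p x + b * q x) ∂P = a * ∫ x, r x * p x ∂P + b * ∫ x, r x * q x ∂P := by
  rw [← integral_const_mul, ← integral_const_mul,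
    ← integral_add (hp.integrable_gain.const_mul a) (hq.integrable_gain.const_mul b)]
  congr 1 with x
  ring

lemma cost_combo_le [IsFiniteMeasure P] (hf : IsEntropy S f) (hp : FiniteCost P S f r p)
    (hq : FiniteCost P S f r q) {a b : ℝ} (ha : 0 ≤ a) (hb : 0 ≤ b) (hab : a + b = 1) :
    ∫ x, f (a * p x + b * q x) ∂P ≤ a * ∫ x, f (p x) ∂P + b * ∫ x, f (q x) ∂P := by
  rw [← integral_const_mul, ← integral_const_mul,
    ← integral_add (hp.integrable_cost.const_mul a) (hq.integrable_cost.const_mul b)]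
  exact integral_mono_ae (combo hf hp hq ha hb hab).integrable_cost
    ((hp.integrable_cost.const_mul a).add (hq.integrable_cost.const_mul b))
    (combo_cost_le hf hp hq ha hb hab)

lemma penalized_combo_le [IsFiniteMeasure P] (hf : IsEntropy S f) (hp : FiniteCost P S f r p)
    (hq : FiniteCost P S f r q) {a b lam : ℝ} (ha : 0 ≤ a) (hb : 0 ≤ b) (hab : a + b = 1)
    (hlam : 0 ≤ lam) : penalized P f r lam (fun x => a * p x + b * q x) ≤
      a * penalized P f r lam p + b * penalized P f r lam q := by
  rw [(combo hf hp hq ha hb hab).penalized_eq, hp.penalized_eq, hq.penalized_eq,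
    gain_combo hp hq]
  have := mul_le_mul_of_nonneg_left (cost_combo_le hf hp hq ha hb hab) hlam
  linarith

open Classical in
lemma piecewise (hp : FiniteCost P S f r p) (hq : FiniteCost P S f r q) {A : Set X}
    (hA : MeasurableSet A) : FiniteCost P S f r (A.piecewise q p) where
  mem := by
    filter_upwards [hp.mem, hq.mem] with x h1 h2
    by_cases hx : x ∈ A <;> simp [hx, h1, h2]
  integrable := Integrable.piecewise hA hq.integrable.integrableOn hp.integrable.integrableOn
  integrable_cost := by
    refine (Integrable.piecewise hA hq.integrable_cost.integrableOn
      hp.integrable_cost.integrableOn).congr (Eventually.of_forall fun x => ?_)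
    by_cases hx : x ∈ A <;> simp [hx]
  integrable_gain := by
    refine (Integrable.piecewise hA hq.integrable_gain.integrableOn
      hp.integrable_gain.integrableOn).congr (Eventually.of_forall fun x => ?_)
    by_cases hx : x ∈ A <;> simp [hx]

lemma cost_nonneg [IsProbabilityMeasure P] (hf : IsEntropy S f) (hq : FiniteCost P S f r q)
    (h1 : ∫ x, q x ∂P = 1) : 0 ≤ ∫ x, f (q x) ∂P := by
  obtain ⟨k, hk⟩ := hf.exists_affine_le
  have h2 : ∫ x, k * (q x - 1) ∂P = 0 := by
    rw [integral_const_mul, integral_sub hq.integrable (integrable_const 1), h1]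
    simp
  rw [← h2]
  refine integral_mono_ae ((hq.integrable.sub (integrable_const 1)).const_mul k)
    hq.integrable_cost ?_
  filter_upwards [hq.mem] with x hx using hk _ hx

end FiniteCost

namespace IsPenalizedMin

variable {lam : ℝ} {p : X → ℝ}

/-- The cost of the minimizer decreases with the penalty. -/
lemma cost_antitoneOn {q : ℝ → X → ℝ}
    (hq : ∀ lam, 0 < lam → IsPenalizedMin P S f r lam (q lam)) {lam mu : ℝ} (hlam : 0 < lam)
    (hle : lam ≤ mu) : ∫ x, f (q mu x) ∂P ≤ ∫ x, f (q lam x) ∂P := by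
  rcases hle.eq_or_lt with rfl | hlt
  · exact le_rfl
  have h1 := hq lam hlam
  have h2 := hq mu (hlam.trans hlt)
  have h3 := h1.le _ h2.finiteCost h2.mass
  have h4 := h2.le _ h1.finiteCost h1.mass
  rw [h1.finiteCost.penalized_sub mu lam, h2.finiteCost.penalized_sub mu lam] at h4
  have h5 : (mu - lam) * ∫ x, f (q mu x) ∂P ≤ (mu - lam) * ∫ x, f (q lam x) ∂P := by linarith
  exact le_of_mul_le_mul_left h5 (sub_pos.2 hlt)

/-- A Lagrange multiplier for the constraint `∫ q dP = 1`: a slope separating the difference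
quotients of the objective at densities of mass below and above one. -/
lemma exists_multiplier [IsProbabilityMeasure P] (hf : IsEntropy S f) (hr : Integrable r P)
    (hlam : 0 ≤ lam) (hp : IsPenalizedMin P S f r lam p) :
    ∃ c : ℝ, ∀ q, FiniteCost P S f r q →
      penalized P f r lam p + c * (∫ x, q x ∂P - 1) ≤ penalized P f r lam q := by
  set J := penalized P f r lam
  let D : Set ℝ := {s | ∃ q, FiniteCost P S f r q ∧ ∫ x, q x ∂P < 1 ∧
    s = (J p - J q) / (1 - ∫ x, q x ∂P)}
  have hsep : ∀ q, FiniteCost P S f r q → 1 < ∫ x, q x ∂P → ∀ s ∈ D,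
      s ≤ (J q - J p) / (∫ x, q x ∂P - 1) := by
    rintro q₂ h₂ hm₂ s ⟨q₁, h₁, hm₁, rfl⟩
    set m₁ := ∫ x, q₁ x ∂P
    set m₂ := ∫ x, q₂ x ∂P
    have hd : 0 < m₂ - m₁ := by linarith
    have ha : 0 ≤ (m₂ - 1) / (m₂ - m₁) := div_nonneg (by linarith) hd.le
    have hb : 0 ≤ (1 - m₁) / (m₂ - m₁) := div_nonneg (by linarith) hd.le
    have hab : (m₂ - 1) / (m₂ - m₁) + (1 - m₁) / (m₂ - m₁) = 1 := by
      rw [← add_div, div_eq_one_iff_eq hd.ne']; ring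
    have h3 := hp.le _ (h₁.combo hf h₂ ha hb hab) (by
      rw [h₁.mass_combo h₂]
      change (m₂ - 1) / (m₂ - m₁) * m₁ + (1 - m₁) / (m₂ - m₁) * m₂ = 1
      rw [div_mul_eq_mul_div, div_mul_eq_mul_div, ← add_div, div_eq_one_iff_eq hd.ne']
      ring)
    have h4 := h3.trans (h₁.penalized_combo_le hf h₂ ha hb hab hlam)
    change J p ≤ (m₂ - 1) / (m₂ - m₁) * J q₁ + (1 - m₁) / (m₂ - m₁) * J q₂ at h4
    rw [div_mul_eq_mul_div, div_mul_eq_mul_div, ← add_div, le_div_iff₀ hd] at h4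
    rw [div_le_div_iff₀ (by linarith) (by linarith)]
    linarith
  have hne : D.Nonempty := ⟨_, fun _ => 1 / 2,
    FiniteCost.const hr (hf.pos (mem_Ioi.2 (by norm_num))), by simp; norm_num, rfl⟩
  have hbdd : BddAbove D := ⟨_, hsep (fun _ => 2)
    (FiniteCost.const hr (hf.pos (mem_Ioi.2 (by norm_num)))) (by simp)⟩
  refine ⟨sSup D, fun q hq => ?_⟩
  rcases lt_trichotomy (∫ x, q x ∂P) 1 with h | h | h
  · have h1 : (J p - J q) / (1 - ∫ x, q x ∂P) ≤ sSup D := le_csSup hbdd ⟨q, hq, h, rfl⟩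
    rw [div_le_iff₀ (by linarith)] at h1
    linarith
  · rw [h]
    have : J p ≤ J q := hp.le q hq h
    linarith
  · have h1 : sSup D ≤ _ := csSup_le hne (hsep q hq h)
    rw [le_div_iff₀ (by linarith)] at h1
    linarith

/-- The multiplier makes the minimizer pointwise optimal: the inequality for integrals is localized
by replacing the minimizer on an arbitrary measurable set. -/
lemma exists_pointwise_multiplier [IsProbabilityMeasure P] (hf : IsEntropy S f)
    (hr : Integrable r P) (hlam : 0 ≤ lam) (hp : IsPenalizedMin P S f r lam p) :
    ∃ c : ℝ, ∀ q, FiniteCost P S f r q →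
      ∀ᵐ x ∂P, lam * f (p x) - r x * p x - c * p x ≤ lam * f (q x) - r x * q x - c * q x := by
  classical
  obtain ⟨c, hc⟩ := hp.exists_multiplier hf hr hlam
  have hint : ∀ q, FiniteCost P S f r q →
      Integrable (fun x => lam * f (q x) - r x * q x - c * q x) P := fun q hq =>
    (hq.integrable_penalized lam).sub (hq.integrable.const_mul c)
  have hval : ∀ q, FiniteCost P S f r q →
      ∫ x, lam * f (q x) - r x * q x - c * q x ∂P = penalized P f r lam q - c * ∫ x, q x ∂P := by
    intro q hq
    rw [integral_sub (hq.integrable_penalized lam) (hq.integrable.const_mul c),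
      integral_const_mul, penalized]
  refine ⟨c, fun q hq => ae_le_of_forall_setIntegral_le (hint p hp.finiteCost) (hint q hq) ?_⟩
  intro A hA _
  have hpq := hp.finiteCost.piecewise hq hA
  have h1 := hc _ hpq
  have h2 := hval _ hpq
  have h3 := hval _ hp.finiteCost
  rw [hp.mass] at h3
  have h4 : (fun x => lam * f (A.piecewise q p x) - r x * A.piecewise q p x
      - c * A.piecewise q p x) = A.piecewise (fun x => lam * f (q x) - r x * q x - c * q x)
      (fun x => lam * f (p x) - r x * p x - c * p x) := by
    ext x
    by_cases hx : x ∈ A <;> simp [hx]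
  rw [h4, integral_piecewise hA (hint q hq).integrableOn (hint p hp.finiteCost).integrableOn] at h2
  rw [← integral_add_compl hA (hint p hp.finiteCost)] at h3
  linarith

end IsPenalizedMin

end Lagrangian

/-! ### Activity of the constraint at a dual maximizer -/

section Envelope

variable {X : Type*} [MeasurableSpace X] {P : Measure X} [IsProbabilityMeasure P] {S : Set ℝ}
  {f : ℝ → ℝ} {r : X → ℝ}

namespace IsPenalizedMin

/-- Minimizing sequences of probability densities converge almost everywhere to the minimizer along
a subsequence: by optimality at their midpoints, the midpoint gaps tend to zero in `L¹`. -/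
lemma exists_subseq_tendsto_ae (hf : IsEntropy S f) {lam : ℝ} (hlam : 0 < lam) {p : X → ℝ}
    (hp : IsPenalizedMin P S f r lam p) {q : ℕ → X → ℝ} (hq : ∀ n, FiniteCost P S f r (q n))
    (hmass : ∀ n, ∫ x, q n x ∂P = 1)
    (hlim : Tendsto (fun n => penalized P f r lam (q n)) atTop (𝓝 (penalized P f r lam p))) :
    ∃ ns : ℕ → ℕ, StrictMono ns ∧ ∀ᵐ x ∂P, Tendsto (fun n => q (ns n) x) atTop (𝓝 (p x)) := by
  have hp1 := hp.finiteCost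
  have hmid : ∀ n, FiniteCost P S f r (fun x => 1 / 2 * q n x + 1 / 2 * p x) := fun n =>
    (hq n).combo hf hp1 (by norm_num) (by norm_num) (by norm_num)
  let G : ℕ → X → ℝ := fun n x => f (q n x) + f (p x) - 2 * f (1 / 2 * q n x + 1 / 2 * p x)
  have hG0 : ∀ n, ∀ᵐ x ∂P, 0 ≤ G n x := by
    intro n
    filter_upwards [(hq n).combo_cost_le hf hp1 (show (0 : ℝ) ≤ 1 / 2 by norm_num)
      (show (0 : ℝ) ≤ 1 / 2 by norm_num) (by norm_num)] with x hx
    simp only [G]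
    linarith
  have hGint : ∀ n, Integrable (G n) P := fun n =>
    ((hq n).integrable_cost.add hp1.integrable_cost).sub ((hmid n).integrable_cost.const_mul 2)
  have hGle : ∀ n, ∫ x, G n x ∂P ≤
      lam⁻¹ * (penalized P f r lam (q n) - penalized P f r lam p) := by
    intro n
    have h1 := hp.le _ (hmid n) (by rw [(hq n).mass_combo hp1, hmass, hp.mass]; norm_num)
    have h2 : ∫ x, G n x ∂P = ∫ x, f (q n x) ∂P + ∫ x, f (p x) ∂P
        - 2 * ∫ x, f (1 / 2 * q n x + 1 / 2 * p x) ∂P := by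
      rw [← integral_const_mul, ← integral_add (hq n).integrable_cost hp1.integrable_cost]
      exact integral_sub ((hq n).integrable_cost.add hp1.integrable_cost)
        ((hmid n).integrable_cost.const_mul 2)
    rw [hp1.penalized_eq, (hmid n).penalized_eq, (hq n).gain_combo hp1] at h1
    rw [hp1.penalized_eq, (hq n).penalized_eq, h2, inv_mul_eq_div, le_div_iff₀ hlam]
    linarith
  have hGlim : Tendsto (fun n => ∫ x, G n x ∂P) atTop (𝓝 0) := by
    refine squeeze_zero (fun n => integral_nonneg_of_ae (hG0 n)) hGle ?_
    simpa using (hlim.sub_const (penalized P f r lam p)).const_mul lam⁻¹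
  have hmeas : TendstoInMeasure P G atTop (fun _ => (0 : ℝ)) := by
    refine tendstoInMeasure_of_tendsto_eLpNorm one_ne_zero (fun n => (hGint n).1)
      aestronglyMeasurable_const ?_
    have h1 : ∀ n, eLpNorm (G n - fun _ => (0 : ℝ)) 1 P = ENNReal.ofReal (∫ x, G n x ∂P) := by
      intro n
      have h0 : G n - (fun _ => (0 : ℝ)) = G n := by ext x; simp
      rw [h0, eLpNorm_one_eq_lintegral_enorm,
        ofReal_integral_eq_lintegral_ofReal (hGint n) (hG0 n)]
      refine lintegral_congr_ae ?_
      filter_upwards [hG0 n] with x hx using Real.enorm_eq_ofReal hx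
    simp_rw [h1]
    simpa [Function.comp_def] using (ENNReal.continuous_ofReal.tendsto 0).comp hGlim
  obtain ⟨ns, hns, hae⟩ := hmeas.exists_seq_tendsto_ae
  refine ⟨ns, hns, ?_⟩
  filter_upwards [hae, hp1.mem, ae_all_iff.2 fun n => (hq n).mem] with x hx hpx hqx
  refine hf.strictConvexOn.tendsto_of_midpoint_gap hpx (fun n => hqx (ns n)) ?_
  refine hx.congr fun n => ?_
  simp only [G]
  ring_nf

/-- If a minimizing sequence at `lam` has costs on the same side of `ε` as `lam'` prescribes, then
so has the minimizer at `lam`. Fatou's lemma applies to the objective at `lam'`, tilted by the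
multiplier of its own minimizer, which supplies the integrable minorant. -/
lemma mul_cost_sub_nonpos (hf : IsEntropy S f) (hr : Integrable r P) {lam lam' ε : ℝ}
    (hlam : 0 < lam) (hlam' : 0 < lam') {p p' : X → ℝ} (hp : IsPenalizedMin P S f r lam p)
    (hp' : IsPenalizedMin P S f r lam' p') {q : ℕ → X → ℝ} (hq : ∀ n, FiniteCost P S f r (q n))
    (hmass : ∀ n, ∫ x, q n x ∂P = 1)
    (hlim : Tendsto (fun n => penalized P f r lam (q n)) atTop (𝓝 (penalized P f r lam p)))
    (hside : ∀ n, (lam' - lam) * (∫ x, f (q n x) ∂P - ε) ≤ 0) :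
    (lam' - lam) * (∫ x, f (p x) ∂P - ε) ≤ 0 := by
  obtain ⟨ns, hns, hae⟩ := hp.exists_subseq_tendsto_ae hf hlam hq hmass hlim
  obtain ⟨c, hc⟩ := hp'.exists_pointwise_multiplier hf hr hlam'.le
  have hint : ∀ q, FiniteCost P S f r q →
      Integrable (fun x => lam' * f (q x) - r x * q x - c * q x) P := fun q hq =>
    (hq.integrable_penalized lam').sub (hq.integrable.const_mul c)
  have hval : ∀ q, FiniteCost P S f r q → ∫ x, q x ∂P = 1 →
      ∫ x, lam' * f (q x) - r x * q x - c * q x ∂P =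
        penalized P f r lam q + (lam' - lam) * ∫ x, f (q x) ∂P - c := by
    intro q hq hq1
    rw [integral_sub (hq.integrable_penalized lam') (hq.integrable.const_mul c),
      integral_const_mul, hq1, ← hq.penalized_sub lam' lam, penalized, mul_one]
  have hpt : ∀ᵐ x ∂P, Tendsto
      (fun n => lam' * f (q (ns n) x) - r x * q (ns n) x - c * q (ns n) x) atTop
      (𝓝 (lam' * f (p x) - r x * p x - c * p x)) := by
    filter_upwards [hae, hp.finiteCost.mem, ae_all_iff.2 fun n => (hq n).mem] with x hx hpx hqx
    have hfx : Tendsto (fun n => f (q (ns n) x)) atTop (𝓝 (f (p x))) :=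
      (hf.continuousOn _ hpx).tendsto.comp
        (tendsto_nhdsWithin_iff.2 ⟨hx, Eventually.of_forall fun n => hqx (ns n)⟩)
    exact ((hfx.const_mul lam').sub (hx.const_mul (r x))).sub (hx.const_mul c)
  have hfat := integral_le_of_tendsto_ae (fun n => hint _ (hq (ns n))) (hint _ hp.finiteCost)
    (hint _ hp'.finiteCost) (fun n => hc _ (hq (ns n))) hpt
    (C := fun n => penalized P f r lam (q (ns n)) + (lam' - lam) * ε - c)
    (fun n => by rw [hval _ (hq _) (hmass _)]; linarith [hside (ns n)])
    (((hlim.comp hns.tendsto_atTop).add_const _).sub_const _)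
  rw [hval _ hp.finiteCost hp.mass] at hfat
  linarith

variable {q : ℝ → X → ℝ}

/-- The minimizers for penalties tending to `lam` from the side of `lam'` form a minimizing sequence
at `lam`, and maximality of the dual value at `lam` puts their costs on one side of `ε`. -/
lemma mul_cost_sub_nonpos_of_dual_max (hf : IsEntropy S f) (hr : Integrable r P)
    (hq : ∀ lam, 0 < lam → IsPenalizedMin P S f r lam (q lam)) {lam lam' ε : ℝ} (hlam : 0 < lam)
    (hlam' : 0 < lam')
    (hmax : ∀ mu, 0 < mu →
      penalized P f r mu (q mu) - mu * ε ≤ penalized P f r lam (q lam) - lam * ε) :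
    (lam' - lam) * (∫ x, f (q lam x) ∂P - ε) ≤ 0 := by
  let θ : ℕ → ℝ := fun n => 1 / ((n : ℝ) + 1)
  have hθ0 : ∀ n, 0 < θ n := fun n => Nat.one_div_pos_of_nat
  have hθ1 : ∀ n, θ n ≤ 1 := fun n => by
    simp only [θ]
    rw [div_le_one (by positivity)]
    have : (0 : ℝ) ≤ n := n.cast_nonneg
    linarith
  have hθ : Tendsto θ atTop (𝓝 0) := tendsto_one_div_add_atTop_nhds_zero_nat
  let mu : ℕ → ℝ := fun n => lam + θ n * (lam' - lam)
  have hmin : 0 < min lam lam' := lt_min hlam hlam'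
  have hmu_ge : ∀ n, min lam lam' ≤ mu n := fun n => by
    have h1 : mu n = (1 - θ n) * lam + θ n * lam' := by simp only [mu]; ring
    have h2 := mul_le_mul_of_nonneg_left (min_le_left lam lam') (sub_nonneg.2 (hθ1 n))
    have h3 := mul_le_mul_of_nonneg_left (min_le_right lam lam') (hθ0 n).le
    linarith
  have hmu : ∀ n, 0 < mu n := fun n => hmin.trans_le (hmu_ge n)
  have hopt := fun n => hq (mu n) (hmu n)
  have h0 := hq lam hlam
  refine mul_cost_sub_nonpos hf hr hlam hlam' h0 (hq lam' hlam')
    (fun n => (hopt n).finiteCost) (fun n => (hopt n).mass) ?_ fun n => ?_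
  · let K := ∫ x, f (q (min lam lam') x) ∂P
    let d := ∫ x, f (q lam x) ∂P
    have hup : ∀ n, penalized P f r lam (q (mu n)) ≤
        penalized P f r lam (q lam) + θ n * (|lam' - lam| * (d + K)) := by
      intro n
      have h1 := (hopt n).le _ h0.finiteCost h0.mass
      rw [(hopt n).finiteCost.penalized_sub (mu n) lam, h0.finiteCost.penalized_sub (mu n) lam]
        at h1
      have h2 : mu n - lam = θ n * (lam' - lam) := by simp only [mu]; ring
      have h3 : |d - ∫ x, f (q (mu n) x) ∂P| ≤ d + K := by
        have h4 := (hopt n).finiteCost.cost_nonneg hf (hopt n).mass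
        have h5 : 0 ≤ d := h0.finiteCost.cost_nonneg hf h0.mass
        have h6 : ∫ x, f (q (mu n) x) ∂P ≤ K := cost_antitoneOn hq hmin (hmu_ge n)
        rw [abs_le]
        constructor <;> linarith
      have h7 : (lam' - lam) * (d - ∫ x, f (q (mu n) x) ∂P) ≤ |lam' - lam| * (d + K) :=
        (le_abs_self _).trans
          ((abs_mul _ _).le.trans (mul_le_mul_of_nonneg_left h3 (abs_nonneg _)))
      have h8 := mul_le_mul_of_nonneg_left h7 (hθ0 n).le
      rw [h2] at h1
      change _ + _ ≤ _ + _ * (lam' - lam) * d at h1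
      linarith
    refine tendsto_of_tendsto_of_tendsto_of_le_of_le tendsto_const_nhds ?_
      (fun n => h0.le _ (hopt n).finiteCost (hopt n).mass) hup
    simpa using (hθ.mul_const (|lam' - lam| * (d + K))).const_add (penalized P f r lam (q lam))
  · have h1 := hmax (mu n) (hmu n)
    have h2 := h0.le _ (hopt n).finiteCost (hopt n).mass
    rw [(hopt n).finiteCost.penalized_sub (mu n) lam] at h1
    have h3 : θ n * ((lam' - lam) * (∫ x, f (q (mu n) x) ∂P - ε)) ≤ θ n * 0 := by
      have h4 : mu n - lam = θ n * (lam' - lam) := by simp only [mu]; ring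
      have h5 : mu n = lam + θ n * (lam' - lam) := rfl
      rw [h4] at h1
      rw [h5] at h1 h2 ⊢
      linarith
    exact le_of_mul_le_mul_left h3 (hθ0 n)

/-- Complementary slackness: at a maximizer of the dual, the divergence constraint is active. -/
theorem cost_eq_of_dual_max (hf : IsEntropy S f) (hr : Integrable r P)
    (hq : ∀ lam, 0 < lam → IsPenalizedMin P S f r lam (q lam)) {lam ε : ℝ} (hlam : 0 < lam)
    (hmax : ∀ mu, 0 < mu →
      penalized P f r mu (q mu) - mu * ε ≤ penalized P f r lam (q lam) - lam * ε) :
    ∫ x, f (q lam x) ∂P = ε := by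
  have h1 := mul_cost_sub_nonpos_of_dual_max hf hr hq hlam (half_pos hlam) hmax
  have h2 := mul_cost_sub_nonpos_of_dual_max hf hr hq hlam
    (mul_pos (zero_lt_two' ℝ) hlam) hmax
  refine le_antisymm ?_ ?_
  · have h3 : lam * (∫ x, f (q lam x) ∂P - ε) ≤ lam * 0 := by linarith
    linarith [le_of_mul_le_mul_left h3 hlam]
  · have h3 : lam * 0 ≤ lam * (∫ x, f (q lam x) ∂P - ε) := by linarith
    linarith [le_of_mul_le_mul_left h3 hlam]

end IsPenalizedMin

end Envelope

/-! ### Extended integrals, divergences and densities -/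

section ExtIntegral

variable {X : Type*} [MeasurableSpace X] {μ : Measure X}

lemma extIntegral_congr_ae {F G : X → EReal} (h : F =ᵐ[μ] G) :
    extIntegral μ F = extIntegral μ G := by
  unfold extIntegral
  congr 2
  · exact lintegral_congr_ae (h.mono fun x hx => by simp only [hx])
  · exact lintegral_congr_ae (h.mono fun x hx => by simp only [hx])

lemma extIntegral_coe_eq (g : X → ℝ) : extIntegral μ (fun x => (g x : EReal)) =
    ((∫⁻ x, ENNReal.ofReal (g x) ∂μ : ℝ≥0∞) : EReal) -
      ((∫⁻ x, ENNReal.ofReal (-g x) ∂μ : ℝ≥0∞) : EReal) := by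
  simp only [extIntegral, ← EReal.coe_neg, EReal.real_coe_toENNReal]

lemma extIntegral_coe {g : X → ℝ} (hg : Integrable g μ) :
    extIntegral μ (fun x => (g x : EReal)) = ((∫ x, g x ∂μ : ℝ) : EReal) := by
  have h1 : ∫⁻ x, ENNReal.ofReal (g x) ∂μ ≠ ⊤ :=
    ((lintegral_mono fun x => Real.ofReal_le_enorm _).trans_lt hg.2).ne
  have h2 : ∫⁻ x, ENNReal.ofReal (-g x) ∂μ ≠ ⊤ :=
    ((lintegral_mono fun x => Real.ofReal_le_enorm _).trans_lt hg.neg.2).ne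
  rw [extIntegral_coe_eq, integral_eq_lintegral_pos_part_sub_lintegral_neg_part hg,
    EReal.coe_sub, EReal.coe_ennreal_toReal h1, EReal.coe_ennreal_toReal h2]

/-- If the extended integral is a real number, then the integrand is almost everywhere finite and
integrable. -/
lemma integrable_of_extIntegral_finite {F : X → EReal} (hF : AEMeasurable F μ)
    (ht : extIntegral μ F ≠ ⊤) (hb : extIntegral μ F ≠ ⊥) :
    (∀ᵐ x ∂μ, F x ≠ ⊤) ∧ Integrable (fun x => (F x).toReal) μ := by
  have h2 : ∫⁻ x, (-F x).toENNReal ∂μ ≠ ⊤ := fun h => hb (by simp [extIntegral, h])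
  have h1 : ∫⁻ x, (F x).toENNReal ∂μ ≠ ⊤ := fun h => ht (by
    rw [extIntegral, h, EReal.coe_ennreal_top, EReal.top_sub (by simpa using h2)])
  have h3 := ae_lt_top' hF.ereal_toENNReal h1
  refine ⟨h3.mono fun x hx => EReal.toENNReal_ne_top_iff.1 hx.ne,
    hF.ereal_toReal.aestronglyMeasurable, ?_⟩
  refine lt_of_le_of_lt (lintegral_mono (g := fun x => (F x).toENNReal + (-F x).toENNReal) ?_)
    (lt_of_eq_of_lt (lintegral_add_left' hF.ereal_toENNReal _)
      (ENNReal.add_lt_top.2 ⟨h1.lt_top, h2.lt_top⟩))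
  intro x
  induction hx : F x with
  | bot => simp [hx]
  | top => simp [hx]
  | coe y =>
    simp only [hx, EReal.toReal_coe, ← EReal.coe_neg, EReal.real_coe_toENNReal]
    rcases le_total 0 y with h | h
    · rw [Real.enorm_eq_ofReal h]; exact le_self_add
    · rw [← enorm_neg, Real.enorm_eq_ofReal (neg_nonneg.2 h)]; exact le_add_self

lemma integrable_of_extIntegral_coe_finite {g : X → ℝ} (hg : AEMeasurable g μ)
    (ht : extIntegral μ (fun x => (g x : EReal)) ≠ ⊤)
    (hb : extIntegral μ (fun x => (g x : EReal)) ≠ ⊥) : Integrable g μ := by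
  simpa using (integrable_of_extIntegral_finite hg.coe_real_ereal ht hb).2

end ExtIntegral

section Density

variable {X : Type*} [MeasurableSpace X] {P Q : Measure X} {φ : ℝ → EReal} {r : X → ℝ}

/-- The real-valued density `dQ/dP`. -/
noncomputable def density (P Q : Measure X) (x : X) : ℝ := (Q.rnDeriv P x).toReal

lemma measurable_density : Measurable (density P Q) :=
  (Measure.measurable_rnDeriv Q P).ennreal_toReal

lemma density_nonneg (x : X) : 0 ≤ density P Q x := ENNReal.toReal_nonneg

lemma integrable_density [IsFiniteMeasure Q] : Integrable (density P Q) P :=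
  Measure.integrable_toReal_rnDeriv

lemma absolutelyContinuous_of_phiDiv_ne_top (h : phiDiv φ P Q ≠ ⊤) : Q ≪ P := by
  by_contra hQ
  exact h (if_neg hQ)

lemma phiDiv_eq (hQ : Q ≪ P) : phiDiv φ P Q = extIntegral P (fun x => φ (density P Q x)) :=
  if_pos hQ

/-- The affine minorant of the generator makes the negative part of the divergence integral
finite. -/
lemma phiDiv_ne_bot [IsFiniteMeasure P] [IsFiniteMeasure Q] (hφ : IsDivGenerator φ)
    (hent : IsEntropy (genDomain φ) fun t => (φ t).toReal) : phiDiv φ P Q ≠ ⊥ := by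
  by_cases hQ : Q ≪ P
  · obtain ⟨a, ha⟩ := hent.exists_affine_le
    have hint : Integrable (fun x => -(a * (density P Q x - 1))) P :=
      ((integrable_density.sub (integrable_const 1)).const_mul a).neg
    have hle : ∫⁻ x, (-φ (density P Q x)).toENNReal ∂P ≤
        ∫⁻ x, ENNReal.ofReal (-(a * (density P Q x - 1))) ∂P := by
      refine lintegral_mono fun x => ?_
      by_cases hx : φ (density P Q x) = ⊤
      · simp [hx]
      · have h1 := ha _ ⟨density_nonneg x, hx⟩
        rw [← hφ.coe_toReal hx, ← EReal.coe_neg, EReal.real_coe_toENNReal]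
        exact ENNReal.ofReal_le_ofReal (neg_le_neg h1)
    have hfin : ∫⁻ x, (-φ (density P Q x)).toENNReal ∂P ≠ ⊤ :=
      (hle.trans_lt ((lintegral_mono fun x => Real.ofReal_le_enorm _).trans_lt hint.2)).ne
    rw [phiDiv_eq hQ, extIntegral]
    lift ∫⁻ x, (-φ (density P Q x)).toENNReal ∂P to NNReal using hfin with B
    intro h
    rcases eq_or_ne (∫⁻ x, (φ (density P Q x)).toENNReal ∂P) ⊤ with h1 | h1
    · rw [h1, EReal.coe_ennreal_top, EReal.top_sub (by simp)] at h
      exact top_ne_bot h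
    · lift ∫⁻ x, (φ (density P Q x)).toENNReal ∂P to NNReal using h1 with A
      rw [EReal.coe_nnreal_eq_coe_real, EReal.coe_nnreal_eq_coe_real, ← EReal.coe_sub] at h
      exact EReal.coe_ne_bot _ h
  · rw [phiDiv, if_neg hQ]
    exact top_ne_bot

lemma mass_density [IsFiniteMeasure P] [IsProbabilityMeasure Q] (hQ : Q ≪ P) :
    ∫ x, density P Q x ∂P = 1 := by
  simp [density, Measure.integral_toReal_rnDeriv hQ]

lemma gain_density [SigmaFinite P] [SigmaFinite Q] (hQ : Q ≪ P) :
    ∫ x, r x * density P Q x ∂P = ∫ x, r x ∂Q := by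
  simp_rw [density, mul_comm (r _)]
  exact integral_toReal_rnDeriv_mul hQ

lemma finiteCost_density [IsFiniteMeasure P] [IsFiniteMeasure Q] (hφ : IsDivGenerator φ)
    (hent : IsEntropy (genDomain φ) fun t => (φ t).toReal) (hD : phiDiv φ P Q ≠ ⊤)
    (hr : Integrable r Q) :
    FiniteCost P (genDomain φ) (fun t => (φ t).toReal) r (density P Q) := by
  have hQ := absolutelyContinuous_of_phiDiv_ne_top hD
  have hb := phiDiv_ne_bot (P := P) (Q := Q) hφ hent
  rw [phiDiv_eq hQ] at hD hb
  have h := integrable_of_extIntegral_finite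
    (hφ.lsc.measurable.comp measurable_density).aemeasurable hD hb
  refine ⟨h.1.mono fun x hx => ⟨density_nonneg x, hx⟩, integrable_density, h.2, ?_⟩
  simp_rw [mul_comm (r _)]
  exact (integrable_toReal_rnDeriv_mul_iff hQ).2 hr

lemma phiDiv_eq_integral (hφ : IsDivGenerator φ) (hQ : Q ≪ P) {q : X → ℝ}
    (hq : FiniteCost P (genDomain φ) (fun t => (φ t).toReal) r q) (hQq : density P Q =ᵐ[P] q) :
    phiDiv φ P Q = ((∫ x, (φ (q x)).toReal ∂P : ℝ) : EReal) := by
  rw [phiDiv_eq hQ, ← extIntegral_coe hq.integrable_cost]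
  refine extIntegral_congr_ae ?_
  filter_upwards [hq.mem, hQq] with x h1 h2
  rw [h2, hφ.coe_toReal h1.2]

lemma integrable_of_density_ae_eq [SigmaFinite P] [SigmaFinite Q] (hQ : Q ≪ P) {q : X → ℝ}
    {S : Set ℝ} {f : ℝ → ℝ} (hq : FiniteCost P S f r q) (hQq : density P Q =ᵐ[P] q) :
    Integrable r Q := by
  rw [← integrable_toReal_rnDeriv_mul_iff hQ]
  refine hq.integrable_gain.congr ?_
  filter_upwards [hQq] with x hx
  rw [← hx, density, mul_comm]

/-- At measures of finite cost the extended-real objective is the penalized objective of the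
density. -/
lemma idealObjective_eq [SigmaFinite P] [SigmaFinite Q] (hφ : IsDivGenerator φ) (hQ : Q ≪ P)
    {q : X → ℝ} (hq : FiniteCost P (genDomain φ) (fun t => (φ t).toReal) r q)
    (hQq : density P Q =ᵐ[P] q) (lam : ℝ) :
    idealObjective φ P (fun R => -extIntegral R fun x => (r x : EReal)) lam Q =
      ((penalized P (fun t => (φ t).toReal) r lam q : ℝ) : EReal) := by
  have h1 := phiDiv_eq_integral hφ hQ hq hQq
  have h2 : ∫ x, r x ∂Q = ∫ x, r x * q x ∂P := by
    rw [← gain_density hQ]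
    refine integral_congr_ae ?_
    filter_upwards [hQq] with x hx
    rw [hx]
  rw [idealObjective, h1, if_neg (EReal.coe_ne_top _),
    extIntegral_coe (integrable_of_density_ae_eq hQ hq hQq), h2, hq.penalized_eq]
  norm_cast
  ring

/-- Every probability density is the density of a probability measure. -/
lemma exists_measure_density_eq [IsProbabilityMeasure P] {q : X → ℝ} (hq : Integrable q P)
    (h0 : ∀ᵐ x ∂P, 0 ≤ q x) (h1 : ∫ x, q x ∂P = 1) :
    ∃ Q : Measure X, IsProbabilityMeasure Q ∧ Q ≪ P ∧ density P Q =ᵐ[P] q := by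
  refine ⟨P.withDensity fun x => ENNReal.ofReal (q x), ⟨?_⟩,
    withDensity_absolutelyContinuous _ _, ?_⟩
  · rw [withDensity_apply _ MeasurableSet.univ, Measure.restrict_univ,
      ← ofReal_integral_eq_lintegral_ofReal hq h0, h1, ENNReal.ofReal_one]
  · filter_upwards [Measure.rnDeriv_withDensity₀ P hq.aemeasurable.ennreal_ofReal, h0]
      with x hx hx0
    rw [density, hx, ENNReal.toReal_ofReal hx0]

/-- The density of a mixture with the reference measure. -/
lemma density_mixture [IsProbabilityMeasure P] [IsFiniteMeasure Q] (hQ : Q ≪ P) {a b : ℝ}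
    (ha : 0 ≤ a) (hb : 0 ≤ b) :
    density P (ENNReal.ofReal a • Q + ENNReal.ofReal b • P) =ᵐ[P]
      fun x => a * density P Q x + b * 1 := by
  have h : ENNReal.ofReal a • Q + ENNReal.ofReal b • P = P.withDensity
      (fun x => ENNReal.ofReal a * Q.rnDeriv P x + ENNReal.ofReal b) := by
    conv_lhs => rw [← Measure.withDensity_rnDeriv_eq Q P hQ]
    have hm := Measure.measurable_rnDeriv Q P
    have := withDensity_add_left (μ := P) (hm.const_mul (ENNReal.ofReal a))
      (fun _ => ENNReal.ofReal b)
    rw [withDensity_const] at this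
    rw [← withDensity_smul _ hm]
    exact this.symm
  rw [h]
  filter_upwards [Measure.rnDeriv_withDensity P (((Measure.measurable_rnDeriv Q P).const_mul
    (ENNReal.ofReal a)).add_const (ENNReal.ofReal b)), Measure.rnDeriv_lt_top Q P] with x hx hx1
  rw [density, hx, ENNReal.toReal_add (ENNReal.mul_ne_top ENNReal.ofReal_ne_top hx1.ne)
    ENNReal.ofReal_ne_top, ENNReal.toReal_mul, ENNReal.toReal_ofReal ha, ENNReal.toReal_ofReal hb,
    mul_one, density]

lemma isProbabilityMeasure_mixture [IsProbabilityMeasure P] [IsProbabilityMeasure Q] {a b : ℝ}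
    (ha : 0 ≤ a) (hb : 0 ≤ b) (hab : a + b = 1) :
    IsProbabilityMeasure (ENNReal.ofReal a • Q + ENNReal.ofReal b • P) := by
  refine ⟨?_⟩
  simp [← ENNReal.ofReal_add ha hb, hab]

end Density

/-! ### Duality for input distributions and for joint distributions -/

section Duality

variable {X : Type*} [MeasurableSpace X] {P : Measure X} [IsProbabilityMeasure P]
  {φ : ℝ → EReal} {r : X → ℝ} {lam ε : ℝ}

lemma IsIdealized.phiDiv_ne_top {Q : Measure X} (hφ : IsDivGenerator φ)
    (hent : IsEntropy (genDomain φ) fun t => (φ t).toReal) (hr : Integrable r P)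
    (hQ : IsIdealized φ P (fun R => -extIntegral R fun x => (r x : EReal)) lam Q) :
    phiDiv φ P Q ≠ ⊤ := by
  intro h
  have h1 := hQ.2 P inferInstance
  have h2 : density P P =ᵐ[P] fun _ => 1 := by
    filter_upwards [Measure.rnDeriv_self P] with x hx
    simp [density, hx]
  rw [idealObjective_eq hφ Measure.AbsolutelyContinuous.rfl
    (FiniteCost.const hr (hent.pos (mem_Ioi.2 one_pos))) h2, idealObjective, if_pos h,
    top_le_iff] at h1
  exact EReal.coe_ne_top _ h1

/-- An idealized distribution has a density minimizing the penalized objective among densities. -/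
lemma IsIdealized.isPenalizedMin {Q : Measure X} (hφ : IsDivGenerator φ)
    (hent : IsEntropy (genDomain φ) fun t => (φ t).toReal) (hr : Integrable r P)
    (hQ : IsIdealized φ P (fun R => -extIntegral R fun x => (r x : EReal)) lam Q)
    (hrQ : Integrable r Q) :
    IsPenalizedMin P (genDomain φ) (fun t => (φ t).toReal) r lam (density P Q) := by
  have := hQ.1
  have hD := hQ.phiDiv_ne_top hφ hent hr
  have hac := absolutelyContinuous_of_phiDiv_ne_top hD
  have hfc := finiteCost_density hφ hent hD hrQ
  refine ⟨hfc, mass_density hac, fun q hq h1 => ?_⟩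
  obtain ⟨R, hR, hRP, hRq⟩ := exists_measure_density_eq hq.integrable
    (hq.mem.mono fun x hx => hx.1) h1
  have h2 := hQ.2 R hR
  rwa [idealObjective_eq hφ hRP hq hRq, idealObjective_eq hφ hac hfc (ae_eq_refl _),
    EReal.coe_le_coe_iff] at h2

/-- Weak duality: an idealized distribution whose divergence is `ε` has the largest risk among the
distributions of divergence at most `ε`. -/
lemma IsIdealized.risk_le {Q R : Measure X} [IsProbabilityMeasure R] (hφ : IsDivGenerator φ)
    (hent : IsEntropy (genDomain φ) fun t => (φ t).toReal) (hr : Integrable r P)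
    (hlam : 0 ≤ lam)
    (hQ : IsIdealized φ P (fun R => -extIntegral R fun x => (r x : EReal)) lam Q)
    (hrQ : Integrable r Q) (hQε : phiDiv φ P Q = (ε : EReal))
    (hR : phiDiv φ P R ≤ (ε : EReal)) :
    extIntegral R (fun x => (r x : EReal)) ≤ extIntegral Q (fun x => (r x : EReal)) := by
  have := hQ.1
  have hD := hQ.phiDiv_ne_top hφ hent hr
  have hac := absolutelyContinuous_of_phiDiv_ne_top hD
  have hfc := finiteCost_density hφ hent hD hrQ
  have hRD : phiDiv φ P R ≠ ⊤ := (hR.trans_lt (EReal.coe_lt_top _)).ne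
  have hRac := absolutelyContinuous_of_phiDiv_ne_top hRD
  have hle := hQ.2 R inferInstance
  have hobj := idealObjective_eq hφ hac hfc (ae_eq_refl _) lam
  by_cases hb : extIntegral R (fun x => (r x : EReal)) = ⊥
  · rw [hb]; exact bot_le
  -- infinite risk at finite divergence would make the objective `-∞`
  have ht : extIntegral R (fun x => (r x : EReal)) ≠ ⊤ := by
    intro ht
    rw [hobj, idealObjective, if_neg hRD, ht, EReal.neg_top, EReal.bot_add, le_bot_iff] at hle
    exact EReal.coe_ne_bot _ hle
  have hrR : Integrable r R :=
    integrable_of_extIntegral_coe_finite (hr.1.mono_ac hRac).aemeasurable ht hb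
  have hRfc := finiteCost_density hφ hent hRD hrR
  rw [hobj, idealObjective_eq hφ hRac hRfc (ae_eq_refl _), EReal.coe_le_coe_iff,
    hfc.penalized_eq, hRfc.penalized_eq, gain_density hac, gain_density hRac] at hle
  rw [phiDiv_eq_integral hφ hac hfc (ae_eq_refl _), EReal.coe_eq_coe_iff] at hQε
  rw [phiDiv_eq_integral hφ hRac hRfc (ae_eq_refl _), EReal.coe_le_coe_iff] at hR
  rw [extIntegral_coe hrR, extIntegral_coe hrQ, EReal.coe_le_coe_iff]
  have h2 := mul_le_mul_of_nonneg_left hR hlam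
  rw [hQε] at hle
  linarith

/-- The divergence constraint is active at a maximizer of the dual problem. -/
lemma phiDiv_eq_of_isMaxOn {Q : ℝ → Measure X} (hφ : IsDivGenerator φ)
    (hent : IsEntropy (genDomain φ) fun t => (φ t).toReal) (hr : Integrable r P)
    (hQ : ∀ mu, 0 < mu →
      IsIdealized φ P (fun R => -extIntegral R fun x => (r x : EReal)) mu (Q mu))
    (hrQ : ∀ mu, 0 < mu → Integrable r (Q mu)) (hlam : 0 < lam)
    (hmax : IsMaxOn (fun mu : ℝ => -extIntegral (Q mu) (fun x => (r x : EReal)) +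
      (mu : EReal) * (phiDiv φ P (Q mu) - (ε : EReal))) (Ioi 0) lam) :
    phiDiv φ P (Q lam) = (ε : EReal) := by
  have hmin := fun mu hmu => (hQ mu hmu).isPenalizedMin hφ hent hr (hrQ mu hmu)
  have hac := fun mu (hmu : 0 < mu) =>
    absolutelyContinuous_of_phiDiv_ne_top ((hQ mu hmu).phiDiv_ne_top hφ hent hr)
  have hval : ∀ mu, 0 < mu → -extIntegral (Q mu) (fun x => (r x : EReal)) +
      (mu : EReal) * (phiDiv φ P (Q mu) - (ε : EReal)) =
      ((penalized P (fun t => (φ t).toReal) r mu (density P (Q mu)) - mu * ε : ℝ) : EReal) := by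
    intro mu hmu
    have := (hQ mu hmu).1
    have hfc := (hmin mu hmu).finiteCost
    rw [extIntegral_coe (hrQ mu hmu), phiDiv_eq_integral hφ (hac mu hmu) hfc (ae_eq_refl _),
      hfc.penalized_eq, gain_density (hac mu hmu)]
    norm_cast
    ring
  rw [phiDiv_eq_integral hφ (hac lam hlam) (hmin lam hlam).finiteCost (ae_eq_refl _),
    EReal.coe_eq_coe_iff]
  refine IsPenalizedMin.cost_eq_of_dual_max hent hr (q := fun mu => density P (Q mu)) hmin hlam
    fun mu hmu => ?_
  have h1 := isMaxOn_iff.1 hmax mu hmu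
  rwa [hval mu hmu, hval lam hlam, EReal.coe_le_coe_iff] at h1

/-- Mixing with the reference measure, which has divergence zero, contracts the divergence. -/
lemma phiDiv_mixture_le {Q : Measure X} [IsProbabilityMeasure Q] (hφ : IsDivGenerator φ)
    (hent : IsEntropy (genDomain φ) fun t => (φ t).toReal) (hr : Integrable r P)
    (hrQ : Integrable r Q) (hQ : phiDiv φ P Q = (ε : EReal)) {a b : ℝ} (ha : 0 ≤ a)
    (hb : 0 ≤ b) (hab : a + b = 1) :
    phiDiv φ P (ENNReal.ofReal a • Q + ENNReal.ofReal b • P) ≤ ((a * ε : ℝ) : EReal) := by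
  have hD : phiDiv φ P Q ≠ ⊤ := hQ ▸ EReal.coe_ne_top _
  have hac := absolutelyContinuous_of_phiDiv_ne_top hD
  have hfc := finiteCost_density hφ hent hD hrQ
  have hone : FiniteCost P (genDomain φ) (fun t => (φ t).toReal) r (fun _ => 1) :=
    FiniteCost.const hr (hent.pos (mem_Ioi.2 one_pos))
  have hmix := hfc.combo hent hone ha hb hab
  have hmac : ENNReal.ofReal a • Q + ENNReal.ofReal b • P ≪ P :=
    (hac.smul_left _).add_left (Measure.AbsolutelyContinuous.rfl.smul_left _)
  rw [phiDiv_eq_integral hφ hac hfc (ae_eq_refl _), EReal.coe_eq_coe_iff] at hQ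
  rw [phiDiv_eq_integral hφ hmac hmix (density_mixture hac ha hb), EReal.coe_le_coe_iff, ← hQ]
  have h := hfc.cost_combo_le hent hone ha hb hab
  simpa [hφ.one] using h

end Duality

section Joint

variable {X Y : Type*} [MeasurableSpace X] [MeasurableSpace Y] {κ : Kernel X Y}
  [IsMarkovKernel κ] {P Q : Measure X} {φ : ℝ → EReal}

/-- Changing only the input marginal, the joint divergence is that of the marginals. -/
lemma phiDiv_compProd [IsFiniteMeasure P] [IsFiniteMeasure Q] (hφ : Measurable φ) :
    phiDiv φ (P ⊗ₘ κ) (Q ⊗ₘ κ) = phiDiv φ P Q := by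
  by_cases hQ : Q ≪ P
  · have hlin : ∀ g : ℝ≥0∞ → ℝ≥0∞, Measurable g →
        ∫⁻ p, g ((Q ⊗ₘ κ).rnDeriv (P ⊗ₘ κ) p) ∂(P ⊗ₘ κ) = ∫⁻ x, g (Q.rnDeriv P x) ∂P := by
      intro g hg
      refine (lintegral_congr_ae ((rnDeriv_measure_compProd_left Q P κ).fun_comp g)).trans ?_
      refine (Measure.lintegral_compProd (f := fun p => g (Q.rnDeriv P p.1))
          (hg.comp ((Measure.measurable_rnDeriv Q P).comp measurable_fst))).trans ?_
      simp
    rw [phiDiv, phiDiv, if_pos hQ, if_pos (Measure.AbsolutelyContinuous.compProd_left hQ κ),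
      extIntegral, extIntegral]
    have hm : Measurable fun z : ℝ≥0∞ => φ z.toReal := hφ.comp ENNReal.measurable_toReal
    rw [hlin (fun z => (φ z.toReal).toENNReal) hm.ereal_toENNReal,
      hlin (fun z => (-φ z.toReal).toENNReal) hm.neg.ereal_toENNReal]
  · rw [phiDiv, phiDiv, if_neg hQ,
      if_neg fun h => hQ (Measure.absolutelyContinuous_compProd_left_iff.1 h)]

lemma MeasureTheory.Integrable.integral_measure_compProd [SFinite P] {g : X × Y → ℝ}
    (hg : Integrable g (P ⊗ₘ κ)) : Integrable (fun x => ∫ y, g (x, y) ∂(κ x)) P := by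
  simpa using Integrable.integral_compProd (κ := Kernel.const Unit P)
    (η := Kernel.prodMkLeft Unit κ) (a := ()) hg

lemma extIntegral_compProd_eq [SFinite Q] {g : X × Y → ℝ} (hg : Integrable g (Q ⊗ₘ κ)) :
    extIntegral (Q ⊗ₘ κ) (fun p => (g p : EReal)) =
      extIntegral Q (fun x => ((∫ y, g (x, y) ∂(κ x) : ℝ) : EReal)) := by
  rw [extIntegral_coe hg, extIntegral_coe hg.integral_measure_compProd,
    Measure.integral_compProd hg]

/-- Integrating out `y` can only increase the extended integral: the joint integral has the
placeholder value `-∞` whenever its negative part is infinite, and otherwise the two agree. -/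
lemma extIntegral_compProd_le [IsFiniteMeasure P] [IsFiniteMeasure Q] (hQ : Q ≪ P)
    {g : X × Y → ℝ} (hg : Integrable g (P ⊗ₘ κ)) :
    extIntegral (Q ⊗ₘ κ) (fun p => (g p : EReal)) ≤
      extIntegral Q (fun x => ((∫ y, g (x, y) ∂(κ x) : ℝ) : EReal)) := by
  have hgm : AEMeasurable g (Q ⊗ₘ κ) :=
    (hg.1.mono_ac (Measure.AbsolutelyContinuous.compProd_left hQ κ)).aemeasurable
  obtain ⟨g', hg'm, hg'⟩ := hgm
  have hae := Measure.ae_ae_of_ae_compProd hg'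
  have hint : ∀ᵐ x ∂Q, Integrable (fun y => g (x, y)) (κ x) :=
    hQ.ae_le ((Measure.integrable_compProd_iff hg.1).1 hg).1
  let a : X → ℝ≥0∞ := fun x => ∫⁻ y, ENNReal.ofReal (g' (x, y)) ∂(κ x)
  let b : X → ℝ≥0∞ := fun x => ∫⁻ y, ENNReal.ofReal (-g' (x, y)) ∂(κ x)
  have ham : Measurable a := hg'm.ennreal_ofReal.lintegral_kernel_prod_right'
  have hbm : Measurable b := hg'm.neg.ennreal_ofReal.lintegral_kernel_prod_right'
  have hA : ∫⁻ p, ENNReal.ofReal (g p) ∂(Q ⊗ₘ κ) = ∫⁻ x, a x ∂Q := by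
    exact (lintegral_congr_ae (hg'.fun_comp ENNReal.ofReal)).trans
      (Measure.lintegral_compProd hg'm.ennreal_ofReal)
  have hB : ∫⁻ p, ENNReal.ofReal (-g p) ∂(Q ⊗ₘ κ) = ∫⁻ x, b x ∂Q := by
    exact (lintegral_congr_ae (hg'.fun_comp fun z => ENNReal.ofReal (-z))).trans
      (Measure.lintegral_compProd hg'm.neg.ennreal_ofReal)
  have hL : ∀ᵐ x ∂Q, ENNReal.ofReal (∫ y, g (x, y) ∂(κ x)) = a x - b x ∧
      ENNReal.ofReal (-∫ y, g (x, y) ∂(κ x)) = b x - a x := by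
    filter_upwards [hint, hae] with x hx hx'
    have ha : a x = ∫⁻ y, ENNReal.ofReal (g (x, y)) ∂(κ x) :=
      lintegral_congr_ae (hx'.mono fun y hy => by simp only [hy])
    have hb : b x = ∫⁻ y, ENNReal.ofReal (-g (x, y)) ∂(κ x) :=
      lintegral_congr_ae (hx'.mono fun y hy => by simp only [hy])
    have ha' : a x ≠ ⊤ :=
      ha ▸ ((lintegral_mono fun y => Real.ofReal_le_enorm _).trans_lt hx.2).ne
    have hb' : b x ≠ ⊤ :=
      hb ▸ ((lintegral_mono fun y => Real.ofReal_le_enorm _).trans_lt hx.neg.2).ne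
    rw [integral_eq_lintegral_pos_part_sub_lintegral_neg_part hx, ← ha, ← hb, neg_sub,
      ENNReal.ofReal_sub _ ENNReal.toReal_nonneg, ENNReal.ofReal_sub _ ENNReal.toReal_nonneg,
      ENNReal.ofReal_toReal ha', ENNReal.ofReal_toReal hb']
    exact ⟨rfl, rfl⟩
  rw [extIntegral_coe_eq, extIntegral_coe_eq, hA, hB,
    lintegral_congr_ae (hL.mono fun x hx => hx.1), lintegral_congr_ae (hL.mono fun x hx => hx.2)]
  by_cases hBt : ∫⁻ x, b x ∂Q = ⊤
  · simp [hBt]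
  have hBA : ∫⁻ x, b x - a x ∂Q ≤ ∫⁻ x, b x ∂Q := lintegral_mono fun x => tsub_le_self
  have hsum : ∫⁻ x, a x - b x ∂Q + ∫⁻ x, b x ∂Q = ∫⁻ x, a x ∂Q + ∫⁻ x, b x - a x ∂Q := by
    rw [← lintegral_add_right _ hbm, ← lintegral_add_left ham]
    exact lintegral_congr fun x => by rw [tsub_add_eq_max, add_tsub_eq_max]
  have hBAt := ne_top_of_le_ne_top hBt hBA
  generalize ∫⁻ x, a x ∂Q = A, ∫⁻ x, b x ∂Q = B, ∫⁻ x, a x - b x ∂Q = A',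
    ∫⁻ x, b x - a x ∂Q = B' at *
  rcases eq_or_ne A' ⊤ with rfl | hA'
  · rw [EReal.coe_ennreal_top, EReal.top_sub (by simpa using hBAt)]
    exact le_top
  have hAt : A ≠ ⊤ := fun h => by
    rw [h, top_add] at hsum
    exact ENNReal.add_ne_top.2 ⟨hA', hBt⟩ hsum
  lift A to NNReal using hAt
  lift B to NNReal using hBt
  lift A' to NNReal using hA'
  lift B' to NNReal using hBAt
  have hsum' : (A' : ℝ) + B = A + B' := by exact_mod_cast hsum
  simp only [EReal.coe_nnreal_eq_coe_real, ← EReal.coe_sub, EReal.coe_le_coe_iff]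
  linarith

end Joint

/-- An upper bound of all proper convex combinations of `x` and `y` bounds `x`. -/
lemma EReal.coe_le_of_forall_combo_le {x y : ℝ} {b : EReal}
    (h : ∀ t : ℝ, 0 < t → t < 1 → (((1 - t) * x + t * y : ℝ) : EReal) ≤ b) : (x : EReal) ≤ b := by
  have h1 : Tendsto (fun t : ℝ => (((1 - t) * x + t * y : ℝ) : EReal)) (𝓝[>] 0)
      (𝓝 (((1 - 0) * x + 0 * y : ℝ) : EReal)) :=
    ((continuous_coe_real_ereal.comp (by fun_prop)).tendsto 0).mono_left nhdsWithin_le_nhds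
  have h2 : (x : EReal) = (((1 - 0) * x + 0 * y : ℝ) : EReal) := by norm_num
  rw [h2]
  refine le_of_tendsto h1 ?_
  filter_upwards [self_mem_nhdsWithin, (eventually_lt_nhds one_pos).filter_mono
    nhdsWithin_le_nhds] with t ht0 ht1 using h t ht0 ht1

/-! ### Optimality of the dual solution -/

theorem corollary3p4
    {X Y Y' : Type*} [MeasurableSpace X] [MeasurableSpace Y]
    (Pxy : Measure (X × Y)) [IsProbabilityMeasure Pxy]
    (κ : Kernel X Y) [IsMarkovKernel κ] [Pxy.IsCondKernel κ]
    (ℓ : Y → Y' → ℝ) (h : X → Y')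
    (hℓ : Integrable (fun p : X × Y => ℓ p.2 (h p.1)) Pxy)
    (φ : ℝ → EReal) (hφ : IsDivGenerator φ)
    (hφ_fin : ∀ z : ℝ, 0 < z → φ z ≠ ⊤)
    (hφ_diff : DifferentiableOn ℝ (fun z => (φ z).toReal) (Ioi 0))
    (hφ_inj : InjOn (deriv fun z => (φ z).toReal) (Ioi 0))
    (ε : ℝ) (hε : 0 < ε)
    (Q : ℝ → Measure X)
    (hQ : ∀ lam : ℝ, 0 < lam →
      IsIdealized φ Pxy.fst (fun R => -inputRisk κ ℓ h R) lam (Q lam))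
    (hQℓ : ∀ lam : ℝ, 0 < lam →
      Integrable (fun p : X × Y => ℓ p.2 (h p.1)) (Q lam ⊗ₘ κ))
    (lams : ℝ) (hlams : 0 < lams)
    (hmax : IsMaxOn
      (fun lam : ℝ => -inputRisk κ ℓ h (Q lam) +
        (lam : EReal) * (phiDiv φ Pxy.fst (Q lam) - (ε : EReal)))
      (Ioi 0) lams) :
    (Q lams ∈ phiClosedBall φ Pxy.fst ε ∧
      IsMaxOn (inputRisk κ ℓ h) (phiClosedBall φ Pxy.fst ε) (Q lams) ∧
      IsLUB (inputRisk κ ℓ h '' phiBall φ Pxy.fst ε) (inputRisk κ ℓ h (Q lams))) ∧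
    (Q lams ⊗ₘ κ ∈ phiClosedBall φ Pxy ε ∩ inputShifts κ ∧
      IsMaxOn (jointRisk ℓ h) (phiClosedBall φ Pxy ε ∩ inputShifts κ) (Q lams ⊗ₘ κ) ∧
      IsLUB (jointRisk ℓ h '' (phiBall φ Pxy ε ∩ inputShifts κ))
        (jointRisk ℓ h (Q lams ⊗ₘ κ))) := by
  have hent := hφ.isEntropy hφ_fin hφ_diff hφ_inj
  have hP : Pxy.fst ⊗ₘ κ = Pxy := Measure.disintegrate Pxy κ
  have hℓ' : Integrable (fun p : X × Y => ℓ p.2 (h p.1)) (Pxy.fst ⊗ₘ κ) := by rwa [hP]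
  have hr : Integrable (condRisk κ ℓ h) Pxy.fst := hℓ'.integral_measure_compProd
  have hQprob : ∀ mu, 0 < mu → IsProbabilityMeasure (Q mu) := fun mu hmu => (hQ mu hmu).1
  have hrQ : ∀ mu, 0 < mu → Integrable (condRisk κ ℓ h) (Q mu) := fun mu hmu =>
    have := hQprob mu hmu
    (hQℓ mu hmu).integral_measure_compProd
  have := hQprob lams hlams
  have hD : phiDiv φ Pxy.fst (Q lams) = (ε : EReal) :=
    phiDiv_eq_of_isMaxOn hφ hent hr hQ hrQ hlams hmax
  have hle : ∀ R ∈ phiClosedBall φ Pxy.fst ε,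
      inputRisk κ ℓ h R ≤ inputRisk κ ℓ h (Q lams) := fun R hR =>
    have := hR.1
    (hQ lams hlams).risk_le hφ hent hr hlams.le (hrQ lams hlams) hD hR.2
  have hLQ : inputRisk κ ℓ h (Q lams) = ((∫ x, condRisk κ ℓ h x ∂(Q lams) : ℝ) : EReal) :=
    extIntegral_coe (hrQ lams hlams)
  have hJQ : jointRisk ℓ h (Q lams ⊗ₘ κ) = inputRisk κ ℓ h (Q lams) :=
    extIntegral_compProd_eq (hQℓ lams hlams)
  have hDκ : ∀ R : Measure X, IsProbabilityMeasure R →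
      phiDiv φ Pxy (R ⊗ₘ κ) = phiDiv φ Pxy.fst R := by
    intro R hR
    have h1 := phiDiv_compProd (P := Pxy.fst) (Q := R) (κ := κ) hφ.lsc.measurable
    rwa [hP] at h1
  have hJle : ∀ R ∈ phiClosedBall φ Pxy ε ∩ inputShifts κ,
      jointRisk ℓ h R ≤ jointRisk ℓ h (Q lams ⊗ₘ κ) := by
    rintro _ ⟨⟨_, hR⟩, R, hRp, rfl⟩
    rw [hDκ R hRp] at hR
    rw [hJQ]
    exact (extIntegral_compProd_le (absolutelyContinuous_of_phiDiv_ne_top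
      (hR.trans_lt (EReal.coe_lt_top _)).ne) hℓ').trans (hle R ⟨hRp, hR⟩)
  -- mixtures with the reference measure approach `Q lams` from inside the open ball
  have hmix : ∀ t : ℝ, 0 < t → t < 1 → ∃ R ∈ phiBall φ Pxy.fst ε,
      Integrable (fun p : X × Y => ℓ p.2 (h p.1)) (R ⊗ₘ κ) ∧ inputRisk κ ℓ h R =
        (((1 - t) * ∫ x, condRisk κ ℓ h x ∂(Q lams) +
          t * ∫ x, condRisk κ ℓ h x ∂Pxy.fst : ℝ) : EReal) := by
    intro t ht0 ht1
    have ht1' : 0 ≤ 1 - t := sub_nonneg.2 ht1.le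
    have hab : 1 - t + t = 1 := by ring
    have hRp := isProbabilityMeasure_mixture (P := Pxy.fst) (Q := Q lams) ht1' ht0.le hab
    refine ⟨ENNReal.ofReal (1 - t) • Q lams + ENNReal.ofReal t • Pxy.fst, ⟨hRp, ?_⟩, ?_, ?_⟩
    · refine (phiDiv_mixture_le hφ hent hr (hrQ lams hlams) hD ht1' ht0.le hab).trans_lt ?_
      rw [EReal.coe_lt_coe_iff]
      have := mul_pos ht0 hε
      linarith
    · rw [Measure.compProd_add_left, Measure.compProd_smul_left, Measure.compProd_smul_left]
      exact ((hQℓ lams hlams).smul_measure ENNReal.ofReal_ne_top).add_measure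
        (hℓ'.smul_measure ENNReal.ofReal_ne_top)
    · have h1 := (hrQ lams hlams).smul_measure (c := ENNReal.ofReal (1 - t)) ENNReal.ofReal_ne_top
      have h2 := hr.smul_measure (c := ENNReal.ofReal t) ENNReal.ofReal_ne_top
      rw [inputRisk, extIntegral_coe (h1.add_measure h2), integral_add_measure h1 h2,
        integral_smul_measure, integral_smul_measure, ENNReal.toReal_ofReal ht1',
        ENNReal.toReal_ofReal ht0.le, smul_eq_mul, smul_eq_mul]
  refine ⟨⟨⟨this, hD.le⟩, hle, ?_, ?_⟩, ⟨⟨inferInstance, ?_⟩, Q lams, this, rfl⟩, hJle, ?_, ?_⟩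
  · rintro _ ⟨R, hR, rfl⟩
    exact hle R ⟨hR.1, hR.2.le⟩
  · intro b hb
    rw [hLQ]
    refine EReal.coe_le_of_forall_combo_le (y := ∫ x, condRisk κ ℓ h x ∂Pxy.fst)
      fun t ht0 ht1 => ?_
    obtain ⟨R, hR, _, hLR⟩ := hmix t ht0 ht1
    rw [← hLR]
    exact hb ⟨R, hR, rfl⟩
  · rw [hDκ _ this]
    exact hD.le
  · rintro _ ⟨R, hR, rfl⟩
    exact hJle R ⟨⟨hR.1.1, hR.1.2.le⟩, hR.2⟩
  · intro b hb
    rw [hJQ, hLQ]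
    refine EReal.coe_le_of_forall_combo_le (y := ∫ x, condRisk κ ℓ h x ∂Pxy.fst)
      fun t ht0 ht1 => ?_
    obtain ⟨R, hR, hRℓ, hLR⟩ := hmix t ht0 ht1
    have := hR.1
    rw [← hLR]
    refine le_of_eq_of_le (extIntegral_compProd_eq hRℓ).symm
      (hb ⟨R ⊗ₘ κ, ⟨⟨inferInstance, ?_⟩, R, hR.1, rfl⟩, rfl⟩)
    rw [hDκ R hR.1]
    exact hR.2
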